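/- Let $K$ be a field and $(f_n)_{n\in\mathbb N}$ a family of polynomials over $K$. The family is in $\mathrm{VP}$ if there are a polynomial $P$ and arithmetic circuits $C_n$ (finite directed acyclic graphs of gates of indegree $0$, labeled by variables or elements of $K$, and of indegree $2$, labeled by $+$ or $\times$, with a distinguished output gate) such that, for all $n$, $C_n$ computes $f_n$, $C_n$ has at most $P(n)$ gates, and $C_n$ is multiplicatively disjoint, i.e. for each $\times$-gate the subcircuits of its two children are disjoint. A $k$-dimensional tensor of order $(n_1,\dots,n_k)$, with positive integers $n_i$, is a map $T$ on $[n_1]\times\dots\times[n_k]$; its size is $n_1\cdots n_k$. If $T$ has order $(n_1,\dots,n_k)$ and $G$ has order $(m_1,\dots,m_l)$ with $k,l\ge 1$ and $n_k=m_1$, their contraction $T*G$ is the tensor of order $(n_1,\dots,n_{k-1},m_2,\dots,m_l)$ with $(T*G)[e_1,e_2]=\sum_{i=1}^{n_k}T[e_1,i]\,G[i,e_2]$. A $\{*\}$-formula is an ordered rooted binary tree whose leaves are labeled by tensors with entries that are variables or elements of $K$ and whose other nodes are contractions $*$ of tensors of matching orders. Its size is the number of its $*$-nodes plus the sum of the sizes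 of its input tensors (the labels of its leaves). It computes the polynomial $f$ if the tensor at its root has exactly one entry, and this entry is $f$. Theorem. 1. If $(f_n)\in\mathrm{VP}$, then there are a polynomial $P$ and $\{*\}$-formulas $F_n$ such that, for all $n$, $F_n$ computes $f_n$, $F_n$ has size at most $P(n)$, and every tensor computed at a node of $F_n$ (leaves included) has dimension at most $3$. 2. Conversely, if there are a polynomial $P$ and $\{*\}$-formulas $F_n$ (with no bound on the dimensions) such that, for all $n$, $F_n$ computes $f_n$ and has size at most $P(n)$, then $(f_n)\in\mathrm{VP}$. -/

import Mathlib

namespace TensorVP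

universe u v

/-! ## Arithmetic circuits -/

/-- The label of a gate of an arithmetic circuit with vertex set `V`. Gates of indegree `0` (inputs)
carry a constant or a variable, gates of indegree `2` carry `+` or `×` and point to their left and
right child. -/
inductive Gate (K : Type u) (σ : Type v) (V : Type) : Type (max u v)
  | const (a : K)
  | var (x : σ)
  | add (l r : V)
  | mul (l r : V)

/-- `g.HasChild u`: the vertex `u` is a child of a gate with label `g`. -/
def Gate.HasChild {K : Type u} {σ : Type v} {V : Type} : Gate K σ V → V → Prop
  | .const _, _ => False
  | .var _, _ => False
  | .add l r, w => w = l ∨ w = r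
  | .mul l r, w => w = l ∨ w = r

/-- An arithmetic circuit over `K` with variables from `σ`: a finite directed acyclic graph of
gates with a distinguished output gate. -/
structure ArithCircuit (K : Type u) (σ : Type v) : Type (max 1 u v) where
  /-- the gates -/
  V : Type
  [fintypeV : Fintype V]
  gate : V → Gate K σ V
  /-- there is no directed cycle -/
  acyclic : ∀ w : V, ¬ Relation.TransGen (fun a b => (gate b).HasChild a) w w
  output : V

namespace ArithCircuit

variable {K : Type u} {σ : Type v}

instance (C : ArithCircuit K σ) : Fintype C.V := C.fintypeV

/-- `C.Child a b`: gate `a` is a child of gate `b`. -/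
def Child (C : ArithCircuit K σ) (a b : C.V) : Prop := (C.gate b).HasChild a

theorem wellFounded_child (C : ArithCircuit K σ) : WellFounded C.Child := by
  have : Std.Irrefl (Relation.TransGen C.Child) := ⟨C.acyclic⟩
  have h : WellFounded (Relation.TransGen C.Child) :=
    Finite.wellFounded_of_trans_of_irrefl _
  exact Subrelation.wf (fun {_ _} hab => Relation.TransGen.single hab) h

/-- The size of a circuit is its number of vertices. -/
def size (C : ArithCircuit K σ) : ℕ := Fintype.card C.V

/-- The polynomial computed by a gate. -/
noncomputable def value [CommSemiring K] (C : ArithCircuit K σ) (w : C.V) : MvPolynomial σ K :=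
  match _h : C.gate w with
  | .const a => MvPolynomial.C a
  | .var x => MvPolynomial.X x
  | .add l r => C.value l + C.value r
  | .mul l r => C.value l * C.value r
termination_by C.wellFounded_child.wrap w
decreasing_by
  all_goals
    show (C.gate w).HasChild _
    rw [_h]
    simp [Gate.HasChild]

/-- The circuit computes the polynomial of its output gate. -/
def Computes [CommSemiring K] (C : ArithCircuit K σ) (f : MvPolynomial σ K) : Prop :=
  C.value C.output = f

/-- The vertices of the subcircuit rooted at `w`. -/
def subcircuit (C : ArithCircuit K σ) (w : C.V) : Set C.V :=
  {a | Relation.ReflTransGen C.Child a w}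

/-- For every `×`-gate, the subcircuits of its two children are disjoint. -/
def MultiplicativelyDisjoint (C : ArithCircuit K σ) : Prop :=
  ∀ w l r : C.V, C.gate w = Gate.mul l r → Disjoint (C.subcircuit l) (C.subcircuit r)

end ArithCircuit

/-- The class `VP`: families of polynomials computed by multiplicatively disjoint arithmetic
circuits of polynomial size. -/
def IsVP {K : Type u} {σ : Type v} [CommSemiring K] (f : ℕ → MvPolynomial σ K) : Prop :=
  ∃ (C : ℕ → ArithCircuit K σ) (P : Polynomial ℕ), ∀ n : ℕ,
    (C n).MultiplicativelyDisjoint ∧ (C n).Computes (f n) ∧ (C n).size ≤ P.eval n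

/-! ## Tensors -/

/-- The domain `[n₁] × ⋯ × [n_k]` of a `k`-dimensional tensor of order `(n₁, …, n_k)`. -/
def Idx : List ℕ+ → Type
  | [] => Unit
  | n :: ns => Fin n × Idx ns

/-- The first part of an index tuple. -/
def Idx.fst : (ns : List ℕ+) → {ms : List ℕ+} → Idx (ns ++ ms) → Idx ns
  | [], _, _ => ()
  | _ :: ns, _, e => (e.1, Idx.fst ns e.2)

/-- The second part of an index tuple. -/
def Idx.snd : (ns : List ℕ+) → {ms : List ℕ+} → Idx (ns ++ ms) → Idx ms
  | [], _, e => e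
  | _ :: ns, _, e => Idx.snd ns e.2

/-- Append one last entry to an index tuple. -/
def Idx.snoc : (ns : List ℕ+) → {m : ℕ+} → Idx ns → Fin m → Idx (ns ++ [m])
  | [], _, _, i => (i, ())
  | _ :: ns, _, e, i => (e.1, Idx.snoc ns e.2 i)

/-- A tensor of order `ns` with entries in `R`; its dimension is `ns.length`. -/
abbrev Tensor (R : Type*) (ns : List ℕ+) : Type _ := Idx ns → R

/-- The size of a tensor of order `(n₁, …, n_k)`: its number of entries `n₁ ⋯ n_k`. -/
def tensorSize (ns : List ℕ+) : ℕ := (ns.map fun n => (n : ℕ)).prod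

/-- The contraction `T * G` on the last dimension of `T` and the first dimension of `G`:
`(T * G)[e₁, e₂] = ∑ i, T[e₁, i] * G[i, e₂]`. -/
def contract {R : Type*} [CommSemiring R] {ns : List ℕ+} {m : ℕ+} {ms : List ℕ+}
    (T : Tensor R (ns ++ [m])) (G : Tensor R (m :: ms)) : Tensor R (ns ++ ms) :=
  fun e => ∑ i : Fin m, T (Idx.snoc ns (Idx.fst ns e) i) * G (i, Idx.snd ns e)

/-! ## `{*}`-formulas -/

/-- `{*}`-formulas over `K` with variables from `σ`, indexed by the order of the tensor which they
compute. The leaves are labeled by tensors whose entries are constants or variables; inner nodes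
are contractions of tensors of matching orders. -/
inductive StarFormula (K : Type u) (σ : Type v) : List ℕ+ → Type (max u v)
  | input {ns : List ℕ+} (T : Tensor (K ⊕ σ) ns) : StarFormula K σ ns
  | star {ns : List ℕ+} {m : ℕ+} {ms : List ℕ+} (F : StarFormula K σ (ns ++ [m]))
      (G : StarFormula K σ (m :: ms)) : StarFormula K σ (ns ++ ms)

namespace StarFormula

variable {K : Type u} {σ : Type v}

/-- The tensor of polynomials computed by a formula. -/
noncomputable def eval [CommSemiring K] {ns : List ℕ+} :
    StarFormula K σ ns → Tensor (MvPolynomial σ K) ns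
  | input T => fun e => Sum.elim MvPolynomial.C MvPolynomial.X (T e)
  | star F G => contract F.eval G.eval

/-- The size of a formula: the number of `*`-gates plus the sizes of the input tensors. -/
def size {ns : List ℕ+} : StarFormula K σ ns → ℕ
  | @input _ _ ns _ => tensorSize ns
  | star F G => F.size + G.size + 1

/-- The maximal dimension of the tensors computed at the gates of a formula. -/
def maxDim {ns : List ℕ+} : StarFormula K σ ns → ℕ
  | @input _ _ ns _ => ns.length
  | @star _ _ ns _ ms F G => max (ns ++ ms).length (max F.maxDim G.maxDim)

/-- The formula computes the polynomial `f`: its output tensor has a single entry, which is `f`. -/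
def Computes [CommSemiring K] {ns : List ℕ+} (F : StarFormula K σ ns)
    (f : MvPolynomial σ K) : Prop :=
  tensorSize ns = 1 ∧ ∀ e : Idx ns, F.eval e = f

end StarFormula

end TensorVP

/-! From formulas to circuits, the tensors at inner nodes may have exponentially many entries, so
they are never written out. Instead one leaves a single position of a tensor free and contracts the
others with given vectors or sums them out. At `F * G` the factor without the free position is first
collapsed to a vector along the contracted index, and this vector becomes one more argument of the
other factor. Every leaf and every argument vector is used once, in its own part of the circuit, so
products have disjoint subcircuits and the size stays quadratic (`StarFormula.circuitComputes`).

From circuits to formulas, the gate values solve a quadratic system `x = Φ(x)`. Marking every gate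
of a parse tree by a variable `z` gives `x = z Φ(x)`, whose solution `G` has, at gate `w`, degree in
`z` at most the size of the subcircuit of `w`; this uses multiplicative disjointness. Newton
iteration, run jointly for the solution and for the inverse of the Jacobian matrix, needs no
division and doubles the `z`-adic precision every two steps (`newton_dvd`). The iterates obey the
same degree bounds (`ParseBound.degree_newton`), so once the precision exceeds the degree the error
is exactly zero, and `z = 1` may be substituted (`ParseBound.newton_eq`).

Logarithmically many steps suffice. Each step is a cubic map of a state vector of polynomial length
(`newtonState_succ`), which tensors of dimension at most 3 realize with three copies of the previous
formula (`StarFormula.exists_cubic`). Tripling the size logarithmically often is polynomial. -/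

namespace TensorVP

/-! ### Composition of multiplicatively disjoint circuits -/

section Circuits

variable {K : Type*} {σ : Type*} [CommSemiring K]

/-- Relabel the children of a gate. -/
def Gate.map {V W : Type} (f : V → W) : Gate K σ V → Gate K σ W
  | .const a => .const a
  | .var x => .var x
  | .add l r => .add (f l) (f r)
  | .mul l r => .mul (f l) (f r)

/-- The polynomial computed by a gate whose children compute the polynomials `x`. -/
noncomputable def Gate.eval {V : Type} (x : V → MvPolynomial σ K) :
    Gate K σ V → MvPolynomial σ K
  | .const a => MvPolynomial.C a
  | .var i => MvPolynomial.X i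
  | .add l r => x l + x r
  | .mul l r => x l * x r

omit [CommSemiring K] in
theorem Gate.hasChild_map {V W : Type} {f : V → W} {g : Gate K σ V} {w : W} :
    (g.map f).HasChild w ↔ ∃ u, g.HasChild u ∧ f u = w := by
  cases g <;> simp [Gate.map, Gate.HasChild, or_and_right, exists_or, eq_comm]

theorem Gate.eval_map {V W : Type} (f : V → W) (g : Gate K σ V) (x : W → MvPolynomial σ K) :
    (g.map f).eval x = g.eval (x ∘ f) := by
  cases g <;> rfl

omit [CommSemiring K] in
theorem Gate.map_eq_mul {V W : Type} {f : V → W} {g : Gate K σ V} {l r : W} :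
    g.map f = .mul l r ↔ ∃ l' r', g = .mul l' r' ∧ f l' = l ∧ f r' = r := by
  cases g <;> simp [Gate.map]

theorem ArithCircuit.value_eq (C : ArithCircuit K σ) (w : C.V) :
    C.value w = (C.gate w).eval C.value := by
  rw [ArithCircuit.value]
  split <;> simp [*, Gate.eval]

/-- A family `v` of polynomials is computed by a multiplicatively disjoint circuit with at most `c`
gates. The circuit comes with a rank function that witnesses acyclicity and with sets `sup w` that
contain the subcircuit of `w`. -/
def CircuitComputes (c : ℕ) {ι : Type} (v : ι → MvPolynomial σ K) : Prop :=
  ∃ (V : Type) (_ : Fintype V) (gate : V → Gate K σ V) (rk : V → ℕ) (sup : V → Set V)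
    (val : V → MvPolynomial σ K) (o : ι → V), Fintype.card V ≤ c ∧
    (∀ w u, (gate w).HasChild u → rk u < rk w ∧ sup u ⊆ sup w) ∧ (∀ w, w ∈ sup w) ∧
    (∀ w l r, gate w = .mul l r → Disjoint (sup l) (sup r)) ∧
    (∀ w, (gate w).eval val = val w) ∧ ∀ i, val (o i) = v i

namespace CircuitComputes

variable {ι ι' : Type} {c c' : ℕ} {v : ι → MvPolynomial σ K} {v' : ι' → MvPolynomial σ K}

theorem mono (h : CircuitComputes c v) (hc : c ≤ c') : CircuitComputes c' v := by
  obtain ⟨V, i, gate, rk, sup, val, o, h1, h2⟩ := h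
  exact ⟨V, i, gate, rk, sup, val, o, h1.trans hc, h2⟩

theorem congr (h : CircuitComputes c v) {w : ι → MvPolynomial σ K} (hw : ∀ i, v i = w i) :
    CircuitComputes c w :=
  funext hw ▸ h

theorem comp (h : CircuitComputes c v) (f : ι' → ι) : CircuitComputes c (fun i => v (f i)) := by
  obtain ⟨V, i, gate, rk, sup, val, o, h1, h2, h3, h4, h5, h6⟩ := h
  exact ⟨V, i, gate, rk, sup, val, o ∘ f, h1, h2, h3, h4, h5, fun i => h6 _⟩

theorem inputs {κ : Type} [Fintype κ] (T : κ → K ⊕ σ) :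
    CircuitComputes (Fintype.card κ)
      (fun k => Sum.elim MvPolynomial.C MvPolynomial.X (T k) : κ → MvPolynomial σ K) := by
  refine ⟨κ, inferInstance, fun k => Sum.elim Gate.const Gate.var (T k), fun _ => 0,
    fun k => {k}, fun k => Sum.elim MvPolynomial.C MvPolynomial.X (T k), id, le_rfl, ?_,
    fun _ => rfl, ?_, ?_, fun _ => rfl⟩
  · intro w u
    dsimp only
    rcases T w with a | x <;> simp [Gate.HasChild]
  · intro w l r
    dsimp only
    rcases T w with a | x <;> simp
  · intro w
    dsimp only
    rcases T w with a | x <;> rfl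

theorem exists_rank_bound {V : Type} [Fintype V] (rk : V → ℕ) : ∃ b, ∀ w, rk w < b :=
  ⟨Finset.univ.sup rk + 1, fun w => Nat.lt_succ_of_le (Finset.le_sup (Finset.mem_univ w))⟩


/-- Add one gate, which is not a multiplication, on top of a circuit. -/
theorem extend (h : CircuitComputes c v) (g : Gate K σ ι) (hg : ∀ l r, g ≠ .mul l r) :
    CircuitComputes (c + 1) (fun i : Option ι => i.elim (g.eval v) v) := by
  obtain ⟨V, _, gate, rk, sup, val, o, h1, h2, h3, h4, h5, h6⟩ := h
  obtain ⟨b, hb⟩ := exists_rank_bound rk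
  have ho : val ∘ o = v := funext h6
  refine ⟨Option V, inferInstance, fun w => w.elim (g.map (some ∘ o)) fun w => (gate w).map some,
    -- The whole vertex set is a crude support for the new gate, harmless because that gate is not a
    -- multiplication.
    fun w => w.elim b rk, fun w => w.elim Set.univ fun w => some '' sup w,
    fun w => w.elim (g.eval v) val, fun i => i.elim none fun i => some (o i), by simpa, ?_, ?_, ?_,
    ?_, ?_⟩
  · rintro (_ | w) u hu
    · obtain ⟨i, -, rfl⟩ := Gate.hasChild_map.1 hu
      exact ⟨hb _, Set.subset_univ _⟩
    · obtain ⟨i, hi, rfl⟩ := Gate.hasChild_map.1 hu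
      exact ⟨(h2 w i hi).1, Set.image_mono (h2 w i hi).2⟩
  · rintro (_ | w)
    · trivial
    · exact ⟨w, h3 w, rfl⟩
  · rintro (_ | w) l r hw
    · obtain ⟨l', r', h, -⟩ := Gate.map_eq_mul.1 hw
      exact absurd h (hg _ _)
    · obtain ⟨l', r', h, rfl, rfl⟩ := Gate.map_eq_mul.1 hw
      exact (Set.disjoint_image_iff (Option.some_injective _)).2 (h4 _ _ _ h)
  · rintro (_ | w)
    · simp only [Option.elim, Gate.eval_map]
      rw [← ho]
      rfl
    · simp only [Option.elim, Gate.eval_map]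
      exact h5 w
  · rintro (_ | i)
    · rfl
    · exact h6 i

/-- Products of the outputs of two circuits. -/
theorem mul (h : CircuitComputes c v) (h' : CircuitComputes c' v') {κ : Type} [Fintype κ]
    (a : κ → ι) (b : κ → ι') :
    CircuitComputes (c + c' + Fintype.card κ) (fun k => v (a k) * v' (b k)) := by
  obtain ⟨V, _, gate, rk, sup, val, o, h1, h2, h3, h4, h5, h6⟩ := h
  obtain ⟨V', _, gate', rk', sup', val', o', h1', h2', h3', h4', h5', h6'⟩ := h'
  obtain ⟨B, hB⟩ := exists_rank_bound rk
  obtain ⟨B', hB'⟩ := exists_rank_bound rk'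
  refine ⟨(V ⊕ V') ⊕ κ, inferInstance,
    Sum.elim (Sum.elim (fun w => (gate w).map (Sum.inl ∘ Sum.inl))
      (fun w => (gate' w).map (Sum.inl ∘ Sum.inr)))
      (fun k => .mul (.inl (.inl (o (a k)))) (.inl (.inr (o' (b k))))),
    Sum.elim (Sum.elim rk rk') (fun _ => max B B'),
    Sum.elim (Sum.elim (fun w => (Sum.inl ∘ Sum.inl) '' sup w)
      (fun w => (Sum.inl ∘ Sum.inr) '' sup' w)) (fun _ => Set.univ),
    Sum.elim (Sum.elim val val') (fun k => v (a k) * v' (b k)), Sum.inr, ?_, ?_, ?_, ?_, ?_,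
    fun _ => rfl⟩
  · simp only [Fintype.card_sum]
    omega
  · rintro ((w | w) | k) u hu
    · obtain ⟨i, hi, rfl⟩ := Gate.hasChild_map.1 hu
      exact ⟨(h2 w i hi).1, Set.image_mono (h2 w i hi).2⟩
    · obtain ⟨i, hi, rfl⟩ := Gate.hasChild_map.1 hu
      exact ⟨(h2' w i hi).1, Set.image_mono (h2' w i hi).2⟩
    · rcases hu with rfl | rfl
      · exact ⟨lt_max_of_lt_left (hB _), Set.subset_univ _⟩
      · exact ⟨lt_max_of_lt_right (hB' _), Set.subset_univ _⟩
  · rintro ((w | w) | k)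
    · exact ⟨w, h3 w, rfl⟩
    · exact ⟨w, h3' w, rfl⟩
    · trivial
  · rintro ((w | w) | k) l r hw
    · obtain ⟨l', r', h, rfl, rfl⟩ := Gate.map_eq_mul.1 hw
      exact (Set.disjoint_image_iff (Sum.inl_injective.comp Sum.inl_injective)).2 (h4 _ _ _ h)
    · obtain ⟨l', r', h, rfl, rfl⟩ := Gate.map_eq_mul.1 hw
      exact (Set.disjoint_image_iff (Sum.inl_injective.comp Sum.inr_injective)).2 (h4' _ _ _ h)
    · obtain ⟨rfl, rfl⟩ := Gate.mul.inj hw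
      rw [Set.disjoint_left]
      rintro _ ⟨x, -, rfl⟩ ⟨y, -, hy⟩
      simp at hy
  · rintro ((w | w) | k)
    · simp only [Sum.elim_inl, Gate.eval_map]
      exact h5 w
    · simp only [Sum.elim_inl, Sum.elim_inr, Gate.eval_map]
      exact h5' w
    · simp [Gate.eval, h6, h6']

/-- The rank increases along edges and so excludes cycles. The sets `sup` increase along edges too,
hence contain the true subcircuits, which inherit their disjointness. -/
theorem exists_circuit (h : CircuitComputes c v) (i : ι) :
    ∃ C : ArithCircuit K σ, C.MultiplicativelyDisjoint ∧ C.Computes (v i) ∧ C.size ≤ c := by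
  obtain ⟨V, hV, gate, rk, sup, val, o, h1, h2, h3, h4, h5, h6⟩ := h
  have hrk : ∀ a b, Relation.TransGen (fun a b => (gate b).HasChild a) a b → rk a < rk b := by
    intro a b hab
    induction hab with
    | single h => exact (h2 _ _ h).1
    | tail _ h ih => exact ih.trans (h2 _ _ h).1
  let C : ArithCircuit K σ := ⟨V, gate, fun w hw => (hrk w w hw).false, o i⟩
  have hval : ∀ w, C.value w = val w := by
    intro w
    induction w using C.wellFounded_child.induction with
    | _ w ih =>
      rw [C.value_eq, ← h5 w]
      change (gate w).eval _ = _
      have ih' : ∀ u, (gate w).HasChild u → C.value u = val u := ih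
      revert ih'
      cases gate w <;> simp +contextual [Gate.eval, Gate.HasChild]
  have hsup : ∀ w, C.subcircuit w ⊆ sup w := by
    intro w a ha
    have : sup a ⊆ sup w := by
      induction ha with
      | refl => exact subset_rfl
      | tail _ h ih => exact ih.trans (h2 _ _ h).2
    exact this (h3 a)
  exact ⟨C, fun w l r h => (h4 w l r h).mono (hsup l) (hsup r), (hval _).trans (h6 i), h1⟩

/-- Sum up the entries of `v` along a map `f`. -/
theorem sum_fiber {κ : Type} [Fintype κ] {v : κ → MvPolynomial σ K} (h : CircuitComputes c v)
    (f : κ → ℕ) :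
    CircuitComputes (c + 1 + Fintype.card κ)
      (fun x => ∑ k, if f k = x then v k else 0 : ℕ → MvPolynomial σ K) := by
  classical
  -- The summands stay among the outputs, so that the induction can still reach them. All
  -- accumulators start at one shared constant `0`, the extra gate in the bound.
  have key : ∀ s : Finset κ, CircuitComputes (c + 1 + s.card)
      (Sum.elim v (fun x : ℕ => ∑ k ∈ s, if f k = x then v k else 0)) := by
    intro s
    induction s using Finset.induction_on with
    | empty =>
      refine (((h.extend (.const 0) (by simp)).comp (Sum.elim some fun _ : ℕ => none)).mono
        (by simp)).congr ?_
      rintro (k | x) <;> simp [Gate.eval]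
    | insert a s ha ih =>
      -- Only the accumulator of the fibre of `a` changes, so each summand costs one gate.
      refine (((ih.extend (.add (.inr (f a)) (.inl a)) (by simp)).comp
        (Sum.elim (some ∘ .inl) fun x : ℕ => if f a = x then none else some (.inr x))).mono
        (by simp [ha, add_assoc])).congr ?_
      rintro (k | x)
      · simp
      · by_cases hx : f a = x <;> simp [hx, Gate.eval, Finset.sum_insert ha, add_comm]
  exact (key Finset.univ).comp Sum.inr

/-- Multiply each entry of `v` with one entry of each member of a family of vectors. -/
theorem mul_prod {κ : Type} [Fintype κ] {v : κ → MvPolynomial σ K} (h : CircuitComputes c v)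
    {ρ : ℕ → ℕ → MvPolynomial σ K} {cost : ℕ → ℕ} (B : Finset ℕ)
    (hρ : ∀ i ∈ B, CircuitComputes (cost i) (ρ i)) (e : κ → ℕ → ℕ) :
    CircuitComputes (c + ∑ i ∈ B, cost i + B.card * Fintype.card κ)
      (fun k => v k * ∏ i ∈ B, ρ i (e k i)) := by
  induction B using Finset.induction_on with
  | empty => simpa using h
  | insert a s ha ih =>
    refine (((ih fun i hi => hρ i (Finset.mem_insert_of_mem hi)).mul
      (hρ a (Finset.mem_insert_self _ _)) id (fun k => e k a)).mono ?_).congr ?_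
    on_goal 2 =>
      intro k
      rw [Finset.prod_insert ha]
      simp only [id]
      ring
    · rw [Finset.sum_insert ha, Finset.card_insert_of_notMem ha]
      linarith

end CircuitComputes
end Circuits

/-! ### Index tuples of tensors -/

section Indices

instance Idx.instFintype : (ns : List ℕ+) → Fintype (Idx ns)
  | [] => inferInstanceAs (Fintype Unit)
  | n :: ns =>
    letI := Idx.instFintype ns
    inferInstanceAs (Fintype (Fin n × Idx ns))

theorem Idx.sum_cons {M : Type*} [AddCommMonoid M] {n : ℕ+} {ns : List ℕ+}
    (f : Idx (n :: ns) → M) : ∑ e, f e = ∑ i : Fin n, ∑ b : Idx ns, f (i, b) :=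
  Fintype.sum_prod_type (α₁ := Fin n) (α₂ := Idx ns) f

theorem Idx.sum_nil {M : Type*} [AddCommMonoid M] (f : Idx [] → M) : ∑ e, f e = f () :=
  Fintype.sum_unique (ι := Unit) f

theorem tensorSize_cons (n : ℕ+) (ns : List ℕ+) :
    tensorSize (n :: ns) = n * tensorSize ns := by
  simp [tensorSize]

theorem tensorSize_pos (ns : List ℕ+) : 0 < tensorSize ns := by
  induction ns with
  | nil => exact Nat.one_pos
  | cons n ns ih =>
    rw [tensorSize_cons]
    exact Nat.mul_pos n.pos ih

theorem Idx.card_eq : (ns : List ℕ+) → Fintype.card (Idx ns) = tensorSize ns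
  | [] => rfl
  | n :: ns => by
    have h : Fintype.card (Idx (n :: ns)) = Fintype.card (Fin n) * Fintype.card (Idx ns) :=
      Fintype.card_prod (Fin n) (Idx ns)
    rw [h, Idx.card_eq ns, Fintype.card_fin, tensorSize_cons]

/-- The entry of an index tuple at a given position, and `0` at positions out of range. -/
def Idx.get : (ns : List ℕ+) → Idx ns → ℕ → ℕ
  | [], _, _ => 0
  | _ :: _, e, 0 => e.1
  | _ :: ns, e, p + 1 => Idx.get ns e.2 p

theorem Idx.sum_append {M : Type*} [AddCommMonoid M] : (ns : List ℕ+) → {ms : List ℕ+} →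
    (f : Idx ns → Idx ms → M) →
    ∑ e : Idx (ns ++ ms), f (Idx.fst ns e) (Idx.snd ns e) = ∑ a, ∑ b, f a b
  | [], _, _ => by rw [Idx.sum_nil]; rfl
  | n :: ns, ms, f => by
    rw [Idx.sum_cons]
    refine (Idx.sum_cons (ns := ns ++ ms) _).trans (Finset.sum_congr rfl fun i _ => ?_)
    exact Idx.sum_append ns fun a b => f (i, a) b

theorem Idx.sum_snoc {M : Type*} [AddCommMonoid M] : (ns : List ℕ+) → {m : ℕ+} →
    (f : Idx (ns ++ [m]) → M) → ∑ e, f e = ∑ a, ∑ i : Fin m, f (Idx.snoc ns a i)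
  | [], m, f => by
    rw [Idx.sum_nil]
    refine (Idx.sum_cons (ns := []) _).trans (Finset.sum_congr rfl fun i _ => ?_)
    rw [Idx.sum_nil]
    rfl
  | n :: ns, m, f => by
    rw [Idx.sum_cons]
    refine (Idx.sum_cons (ns := ns ++ [m]) _).trans (Finset.sum_congr rfl fun i _ => ?_)
    exact Idx.sum_snoc ns fun a => f (i, a)

theorem Idx.get_of_lt : (ns : List ℕ+) → {ms : List ℕ+} → (e : Idx (ns ++ ms)) → {p : ℕ} →
    p < ns.length → Idx.get (ns ++ ms) e p = Idx.get ns (Idx.fst ns e) p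
  | [], _, _, _, h => absurd h (Nat.not_lt_zero _)
  | _ :: _, _, _, 0, _ => rfl
  | _ :: ns, _, e, _ + 1, h => Idx.get_of_lt ns e.2 (Nat.lt_of_succ_lt_succ h)

theorem Idx.get_add_length : (ns : List ℕ+) → {ms : List ℕ+} → (e : Idx (ns ++ ms)) → (p : ℕ) →
    Idx.get (ns ++ ms) e (p + ns.length) = Idx.get ms (Idx.snd ns e) p
  | [], _, _, _ => rfl
  | _ :: ns, _, e, p => Idx.get_add_length ns e.2 p

theorem Idx.fst_snoc : (ns : List ℕ+) → {m : ℕ+} → (a : Idx ns) → (i : Fin m) →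
    Idx.fst ns (Idx.snoc ns a i) = a
  | [], _, _, _ => rfl
  | _ :: ns, _, a, i => Prod.ext rfl (Idx.fst_snoc ns a.2 i)

theorem Idx.snd_snoc : (ns : List ℕ+) → {m : ℕ+} → (a : Idx ns) → (i : Fin m) →
    Idx.snd ns (Idx.snoc ns a i) = (i, ())
  | [], _, _, _ => rfl
  | _ :: ns, _, a, i => Idx.snd_snoc ns a.2 i

theorem Idx.get_snoc_of_lt {ns : List ℕ+} {m : ℕ+} (a : Idx ns) (i : Fin m) {p : ℕ}
    (h : p < ns.length) : Idx.get (ns ++ [m]) (Idx.snoc ns a i) p = Idx.get ns a p := by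
  rw [Idx.get_of_lt ns _ h, Idx.fst_snoc]

theorem Idx.get_snoc_length {ns : List ℕ+} {m : ℕ+} (a : Idx ns) (i : Fin m) :
    Idx.get (ns ++ [m]) (Idx.snoc ns a i) ns.length = i := by
  have h := Idx.get_add_length ns (Idx.snoc ns a i) 0
  rw [zero_add] at h
  rw [h, Idx.snd_snoc]
  rfl

end Indices

/-! ### From formulas to circuits -/

section FormulaToCircuit

variable {K : Type*} {σ : Type*} [CommSemiring K]

omit [CommSemiring K] in
theorem StarFormula.one_le_size {ns : List ℕ+} (F : StarFormula K σ ns) : 1 ≤ F.size := by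
  cases F with
  | input T =>
    exact tensorSize_pos ns
  | star F G => exact Nat.le_add_left _ _

/-- Split a product over positions of a concatenated tuple. -/
theorem prod_positions {R : Type*} [CommMonoid R] (B : Finset ℕ) (L : ℕ) (h : ℕ → R) :
    ∏ i ∈ B, h i = (∏ i ∈ B with i < L, h i) *
      ∏ i ∈ {i ∈ B | ¬ i < L}.image (fun i => i - L), h (i + L) := by
  rw [Finset.prod_image, ← Finset.prod_filter_mul_prod_filter_not B (fun i => i < L)]
  · congr 1
    refine Finset.prod_congr rfl fun i hi => ?_
    rw [Nat.sub_add_cancel (not_lt.1 (Finset.mem_filter.1 hi).2)]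
  · intro i hi j hj hij
    have h1 := (Finset.mem_filter.1 hi).2
    have h2 := (Finset.mem_filter.1 hj).2
    dsimp only at hij
    omega

/-- If some positions `B` of the tensor computed by a formula are contracted with vectors which are
computed by disjoint circuits, and all the other positions except `p` are summed over, then the
resulting vector is computed by a small circuit. -/
theorem StarFormula.circuitComputes {ns : List ℕ+} (F : StarFormula K σ ns) (B : Finset ℕ)
    (ρ : ℕ → ℕ → MvPolynomial σ K) (cost : ℕ → ℕ)
    (hρ : ∀ i ∈ B, CircuitComputes (cost i) (ρ i)) (p : ℕ) :
    CircuitComputes (3 * F.size * (F.size + B.card) + ∑ i ∈ B, cost i)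
      (fun x : ℕ => ∑ e : Idx ns, if Idx.get ns e p = x then
        F.eval e * ∏ i ∈ B, ρ i (Idx.get ns e i) else 0) := by
  induction F generalizing B ρ cost p with
  | @input ns T =>
    refine ((((CircuitComputes.inputs T).mul_prod B hρ (Idx.get ns)).sum_fiber
      (fun e => Idx.get ns e p)).mono ?_).congr fun x => Finset.sum_congr rfl fun e _ => rfl
    have h := StarFormula.one_le_size (StarFormula.input T)
    simp only [StarFormula.size, Idx.card_eq] at h ⊢
    nlinarith
  | @star ns m ms F G ihF ihG =>
    obtain ⟨L, hL⟩ : ∃ L, L = ns.length := ⟨_, rfl⟩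
    have hgetL : ∀ a (i : Fin m), Idx.get (ns ++ [m]) (Idx.snoc ns a i) L = i := by
      rw [hL]
      exact Idx.get_snoc_length
    have hgetlt : ∀ p < L, ∀ a (i : Fin m),
        Idx.get (ns ++ [m]) (Idx.snoc ns a i) p = Idx.get ns a p :=
      fun p hp a i => Idx.get_snoc_of_lt a i (hL ▸ hp)
    set B₁ := {i ∈ B | i < L} with hB₁
    -- Positions of `star F G` from `L` on are renumbered from `0`. As positions of `G` they move up
    -- by one, since position `0` of `G` is the contracted index.
    set B₂ := {i ∈ B | ¬ i < L}.image (fun i => i - L) with hB₂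
    have hm₂ : ∀ i ∈ B₂, i + L ∈ B := by
      intro i hi
      obtain ⟨j, hj, rfl⟩ := Finset.mem_image.1 hi
      obtain ⟨hj, hj'⟩ := Finset.mem_filter.1 hj
      rwa [Nat.sub_add_cancel (not_lt.1 hj')]
    have hm₁ : ∀ i ∈ B₁, i ∈ B ∧ i < L := fun i hi => Finset.mem_filter.1 hi
    have hcard : B.card = B₁.card + B₂.card := by
      have h : ∑ i ∈ B, 1 = ∑ i ∈ B₁, 1 + ∑ i ∈ B₂, 1 :=
        prod_positions (R := Multiplicative ℕ) B L (fun _ => Multiplicative.ofAdd 1)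
      simpa only [← Finset.card_eq_sum_ones] using h
    have hcost : ∑ i ∈ B, cost i = ∑ i ∈ B₁, cost i + ∑ i ∈ B₂, cost (i + L) :=
      prod_positions (R := Multiplicative ℕ) B L (fun i => Multiplicative.ofAdd (cost i))
    have hL₁ : L ∉ B₁ := fun h => (hm₁ _ h).2.false
    have h0 : 0 ∉ B₂.map ⟨Nat.succ, Nat.succ_injective⟩ := by simp
    set Q₁ : Idx ns → MvPolynomial σ K := fun a => ∏ i ∈ B₁, ρ i (Idx.get ns a i) with hQ₁
    set Q₂ : Idx ms → MvPolynomial σ K :=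
      fun b => ∏ i ∈ B₂, ρ (i + L) (Idx.get ms b i) with hQ₂
    have hQ : ∀ e : Idx (ns ++ ms), ∏ i ∈ B, ρ i (Idx.get (ns ++ ms) e i) =
        Q₁ (Idx.fst ns e) * Q₂ (Idx.snd ns e) := by
      intro e
      rw [prod_positions B L, hQ₁, hQ₂]
      congr 1
      · exact Finset.prod_congr rfl fun i hi => by rw [Idx.get_of_lt ns e (hL ▸ (hm₁ i hi).2)]
      · exact Finset.prod_congr rfl fun i hi => by rw [hL, Idx.get_add_length ns e]
    have hQ₁' : ∀ (u : ℕ → MvPolynomial σ K) a (i : Fin m),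
        ∏ j ∈ B₁, (if j < L then ρ j else u) (Idx.get (ns ++ [m]) (Idx.snoc ns a i) j) = Q₁ a := by
      intro u a i
      refine Finset.prod_congr rfl fun j hj => ?_
      rw [if_pos (hm₁ j hj).2, hgetlt j (hm₁ j hj).2]
    have key : ∀ x, (∑ e : Idx (ns ++ ms), if Idx.get (ns ++ ms) e p = x then
        (StarFormula.star F G).eval e * ∏ i ∈ B, ρ i (Idx.get (ns ++ ms) e i) else 0) =
        ∑ a : Idx ns, ∑ b : Idx ms,
          if (if p < L then Idx.get ns a p else Idx.get ms b (p - L)) = x then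
            (∑ i : Fin m, F.eval (Idx.snoc ns a i) * G.eval (i, b)) * (Q₁ a * Q₂ b) else 0 := by
      intro x
      rw [← Idx.sum_append]
      refine Finset.sum_congr rfl fun e _ => ?_
      rw [hQ]
      have : Idx.get (ns ++ ms) e p = if p < L then Idx.get ns (Idx.fst ns e) p else
          Idx.get ms (Idx.snd ns e) (p - L) := by
        split_ifs with h
        · exact Idx.get_of_lt ns e (hL ▸ h)
        · rw [← Idx.get_add_length ns e, ← hL, Nat.sub_add_cancel (not_lt.1 h)]
      rw [this]
      rfl
    by_cases hp : p < L
    -- The free position lies in `F`: collapse `G` to the vector `u` along its position `0`, then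
    -- give `u` to `F` as the argument at its last position `L`.
    · have hu := ihG (B₂.map ⟨Nat.succ, Nat.succ_injective⟩) (fun i => ρ (i - 1 + L))
        (fun i => cost (i - 1 + L)) (by simpa using fun i hi => hρ _ (hm₂ i hi)) 0
      simp only [Finset.prod_map, Finset.sum_map, Finset.card_map, Function.Embedding.coeFn_mk,
        Nat.succ_eq_add_one, Nat.add_sub_cancel] at hu
      set u : ℕ → MvPolynomial σ K := _
      change CircuitComputes _ u at hu
      have hu' : ∀ i : Fin m, u i = ∑ b, G.eval (i, b) * Q₂ b := by
        intro i
        simp only [u]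
        rw [Idx.sum_cons, Finset.sum_eq_single i]
        · simp [Idx.get, hQ₂]
        · intro j _ hj
          simp [Idx.get, Fin.val_inj, hj]
        · simp
      obtain ⟨cu, hcu⟩ : ∃ c, c = 3 * G.size * (G.size + B₂.card) + ∑ i ∈ B₂, cost (i + L) :=
        ⟨_, rfl⟩
      rw [← hcu] at hu
      refine ((ihF (insert L B₁) (fun j => if j < L then ρ j else u)
        (fun j => if j < L then cost j else cu) ?_ p).mono ?_).congr fun x => ?_
      · intro i hi
        rcases Finset.mem_insert.1 hi with rfl | hi
        · simpa using hu
        · simpa [(hm₁ i hi).2] using hρ i (hm₁ i hi).1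
      · have hs : ∑ j ∈ B₁, (if j < L then cost j else cu) = ∑ j ∈ B₁, cost j :=
          Finset.sum_congr rfl fun j hj => if_pos (hm₁ j hj).2
        rw [Finset.sum_insert hL₁, Finset.card_insert_of_notMem hL₁, hs, hcost, hcard, if_neg
          (lt_irrefl L), hcu, StarFormula.size]
        nlinarith [Nat.zero_le (F.size * G.size), Nat.zero_le (F.size * B₂.card),
          Nat.zero_le (G.size * B₁.card)]
      · rw [key, Idx.sum_snoc]
        refine Finset.sum_congr rfl fun a _ => ?_
        simp only [hp, if_true, Finset.prod_insert hL₁, lt_irrefl, if_false, hQ₁', hgetL,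
          hgetlt p hp, hu']
        split_ifs
        · simp only [Finset.sum_mul, Finset.mul_sum]
          rw [Finset.sum_comm]
          exact Finset.sum_congr rfl fun b _ => Finset.sum_congr rfl fun i _ => by ring
        · simp
    · have hu := ihF B₁ ρ cost (fun i hi => hρ i (hm₁ i hi).1) L
      set u : ℕ → MvPolynomial σ K := _
      change CircuitComputes _ u at hu
      have hu' : ∀ i : Fin m, u i = ∑ a, F.eval (Idx.snoc ns a i) * Q₁ a := by
        intro i
        simp only [u]
        rw [Idx.sum_snoc]
        refine Finset.sum_congr rfl fun a _ => ?_
        rw [Finset.sum_eq_single i]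
        · rw [hgetL, if_pos rfl]
          congr 1
          exact Finset.prod_congr rfl fun j hj => by rw [hgetlt j (hm₁ j hj).2]
        · intro j _ hj
          rw [hgetL, if_neg (by simpa [Fin.val_inj] using hj)]
        · simp
      obtain ⟨cu, hcu⟩ : ∃ c, c = 3 * F.size * (F.size + B₁.card) + ∑ i ∈ B₁, cost i := ⟨_, rfl⟩
      rw [← hcu] at hu
      refine ((ihG (insert 0 (B₂.map ⟨Nat.succ, Nat.succ_injective⟩))
        (fun j => if j = 0 then u else ρ (j - 1 + L))
        (fun j => if j = 0 then cu else cost (j - 1 + L)) ?_ (p - L + 1)).mono ?_).congr fun x => ?_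
      · intro i hi
        rcases Finset.mem_insert.1 hi with rfl | hi
        · simpa using hu
        · obtain ⟨j, hj, rfl⟩ := Finset.mem_map.1 hi
          simpa using hρ _ (hm₂ j hj)
      · rw [Finset.sum_insert h0, Finset.card_insert_of_notMem h0, hcost, hcard, if_pos rfl, hcu,
          StarFormula.size, Finset.card_map, Finset.sum_map]
        simp only [Function.Embedding.coeFn_mk, Nat.succ_ne_zero, if_false, Nat.succ_eq_add_one,
          Nat.add_sub_cancel]
        nlinarith [Nat.zero_le (F.size * G.size), Nat.zero_le (F.size * B₂.card),
          Nat.zero_le (G.size * B₁.card)]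
      · rw [key, Idx.sum_cons, Finset.sum_comm, Finset.sum_comm (γ := Idx ns)]
        refine Finset.sum_congr rfl fun b _ => ?_
        simp only [hp, if_false, Finset.prod_insert h0, Finset.prod_map, if_true,
          Function.Embedding.coeFn_mk, Nat.succ_ne_zero, Nat.succ_eq_add_one, Nat.add_sub_cancel,
          Idx.get, hu']
        split_ifs
        · simp only [Finset.sum_mul, Finset.mul_sum]
          rw [Finset.sum_comm]
          exact Finset.sum_congr rfl fun b _ => Finset.sum_congr rfl fun i _ => by
            simp only [hQ₂]
            ring
        · simp

theorem StarFormula.exists_circuit {ns : List ℕ+} (F : StarFormula K σ ns) {f : MvPolynomial σ K}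
    (hF : F.Computes f) : ∃ C : ArithCircuit K σ,
      C.MultiplicativelyDisjoint ∧ C.Computes f ∧ C.size ≤ 3 * F.size ^ 2 := by
  -- The position `ns.length` is out of range, where `Idx.get` returns `0`. Entry `0` of the vector
  -- is therefore the sum over the whole tensor, which has a single entry.
  have h := F.circuitComputes ∅ (fun _ _ => 0) (fun _ => 0) (by simp) ns.length
  obtain ⟨C, h1, h2, h3⟩ := h.exists_circuit 0
  refine ⟨C, h1, ?_, h3.trans_eq (by simp; ring)⟩
  rw [ArithCircuit.Computes] at h2 ⊢
  have hget : ∀ e : Idx ns, Idx.get ns e ns.length = 0 := by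
    intro e
    clear h h1 h2 h3 hF F
    induction ns with
    | nil => rfl
    | cons n ns ih => exact ih e.2
  rw [h2]
  simp [hget, hF.2, Idx.card_eq, hF.1]

theorem isVP_of_starFormula (f : ℕ → MvPolynomial σ K) (ns : ℕ → List ℕ+)
    (F : ∀ n : ℕ, StarFormula K σ (ns n)) (P : Polynomial ℕ)
    (h : ∀ n, (F n).Computes (f n) ∧ (F n).size ≤ P.eval n) : IsVP f := by
  choose C hC using fun n => (F n).exists_circuit (h n).1
  refine ⟨C, 3 * P ^ 2, fun n => ⟨(hC n).1, (hC n).2.1, (hC n).2.2.trans ?_⟩⟩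
  simpa using Nat.pow_le_pow_left (h n).2 2

end FormulaToCircuit

/-! ### Newton iteration for the system of gate equations -/

section Newton

open Matrix

variable {K : Type*} {σ : Type*} {V : Type} {A : Type*} [CommRing A]

/-- The system of equations of a circuit: `gateMap gate lab x w` is the value of the gate `w` if
the gates have the values `x` and the inputs have the values `lab`. -/
def gateMap (gate : V → Gate K σ V) (lab x : V → A) (w : V) : A :=
  match gate w with
  | .const _ => lab w
  | .var _ => lab w
  | .add l r => x l + x r
  | .mul l r => x l * x r

/-- The quadratic part of `gateMap`. -/
def gateQuad (gate : V → Gate K σ V) (x : V → A) (w : V) : A :=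
  match gate w with
  | .mul l r => x l * x r
  | _ => 0

variable [DecidableEq V]

/-- The Jacobian matrix of `gateMap`, homogenized with `o`. -/
def gateJac (gate : V → Gate K σ V) (o : A) (x : V → A) : Matrix V V A := .of fun w u =>
  match gate w with
  | .const _ => 0
  | .var _ => 0
  | .add l r => (if u = l then o else 0) + (if u = r then o else 0)
  | .mul l r => (if u = l then x r else 0) + (if u = r then x l else 0)

variable [Fintype V]

theorem gateMap_add (gate : V → Gate K σ V) (lab x e : V → A) :
    gateMap gate lab (x + e) = gateMap gate lab x + gateJac gate 1 x *ᵥ e + gateQuad gate e := by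
  funext w
  simp only [gateMap, gateJac, gateQuad, Pi.add_apply, mulVec, dotProduct, of_apply]
  cases gate w <;> simp [add_mul, Finset.sum_add_distrib] <;> ring

/-- Joint Newton iteration for the solution of `x = z * gateMap gate lab x` and the inverse of the
Jacobian matrix of `x - z * gateMap gate lab x`. -/
def newton (gate : V → Gate K σ V) (lab : V → A) (z : A) : ℕ → (V → A) × Matrix V V A
  | 0 => (0, 1)
  | t + 1 =>
    let g := (newton gate lab z t).1
    let H := (newton gate lab z t).2
    (g + H *ᵥ (z • gateMap gate lab g - g), H + H - H * (1 - z • gateJac gate 1 g) * H)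

/-- The iteration uses only ring operations. This allows setting the marker `z` to `1` after the
divisibility argument, which would be empty at `z = 1`. -/
theorem newton_map {B : Type*} [CommRing B] (φ : A →+* B) (gate : V → Gate K σ V) (lab : V → A)
    (z : A) (t : ℕ) : newton gate (φ ∘ lab) (φ z) t =
      (φ ∘ (newton gate lab z t).1, (newton gate lab z t).2.map φ) := by
  induction t with
  | zero =>
    refine Prod.ext (funext fun w => (map_zero φ).symm) ?_
    exact (Matrix.map_one φ (map_zero φ) (map_one φ)).symm
  | succ t ih =>
    simp only [newton, ih]
    set g := (newton gate lab z t).1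
    set H := (newton gate lab z t).2
    have h1 : gateMap gate (φ ∘ lab) (φ ∘ g) = φ ∘ gateMap gate lab g := by
      funext w
      simp only [gateMap, Function.comp_apply]
      cases gate w <;> simp
    have h2 : gateJac gate 1 (φ ∘ g) = (gateJac gate 1 g).map φ := by
      ext w u
      simp only [gateJac, Function.comp_apply, map_apply, of_apply]
      cases gate w <;> simp [apply_ite φ]
    refine Prod.ext (funext fun w => ?_) ?_
    · simp [h1, mulVec, dotProduct]
    · ext w u
      simp [h2, Matrix.mul_apply, Matrix.one_apply, apply_ite φ]

/-- One Newton step: if `z ^ a` divides the error of `g` and `z ^ b` divides the error of `H`, then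
the errors after the step are divisible by higher powers. -/
theorem newton_step (gate : V → Gate K σ V) (lab G g : V → A) (H : Matrix V V A) (z : A)
    (hG : G = z • gateMap gate lab G) {a b a' b' : ℕ} (hg : ∀ w, z ^ a ∣ g w - G w)
    (hH : ∀ w u, z ^ b ∣ (1 - H * (1 - z • gateJac gate 1 G)) w u)
    (ha : a' ≤ a + b) (ha' : a' ≤ 2 * a) (hb : b' ≤ a) (hb' : b' ≤ 2 * b) :
    (∀ w, z ^ a' ∣ (g + H *ᵥ (z • gateMap gate lab g - g)) w - G w) ∧
    ∀ w u, z ^ b' ∣ (1 - (H + H - H * (1 - z • gateJac gate 1 g) * H) *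
      (1 - z • gateJac gate 1 G)) w u := by
  set e := g - G with he
  have hge : g = G + e := by simp [he]
  set D := 1 - z • gateJac gate 1 G with hD
  -- With `D` the Jacobian matrix at the exact solution, the first-order error survives only through
  -- the defect `1 - H * D`; the rest is quadratic in `e`.
  have h1 : g + H *ᵥ (z • gateMap gate lab g - g) - G =
      (1 - H * D) *ᵥ e + z • H *ᵥ gateQuad gate e := by
    have : z • gateMap gate lab g - g = - (D *ᵥ e) + z • gateQuad gate e := by
      rw [hge, gateMap_add, smul_add, smul_add, ← hG, hD, sub_mulVec, one_mulVec, smul_mulVec]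
      abel
    rw [this, hge, mulVec_add, mulVec_neg, mulVec_mulVec, sub_mulVec, one_mulVec, mulVec_smul]
    abel
  -- The Jacobian matrix is affine in the point, so its change is linear in `e` and comes from the
  -- multiplication gates only.
  have hE : gateJac gate 1 g - gateJac gate 1 G = .of fun w u => match gate w with
      | .mul l r => (if u = l then e r else 0) + (if u = r then e l else 0)
      | _ => 0 := by
    ext w u
    simp only [gateJac, Matrix.sub_apply, of_apply, he, Pi.sub_apply]
    cases gate w <;> simp
    split_ifs <;> ring
  have h2 : 1 - (H + H - H * (1 - z • gateJac gate 1 g) * H) * D =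
      (1 - H * D) * (1 - H * D) - z • (H * (gateJac gate 1 g - gateJac gate 1 G) * (H * D)) := by
    have : z • (H * (gateJac gate 1 g - gateJac gate 1 G) * (H * D)) =
        H * (D - (1 - z • gateJac gate 1 g)) * (H * D) := by
      rw [hD, ← smul_mul_assoc, ← mul_smul_comm, smul_sub]
      congr 2
      abel
    rw [this]
    noncomm_ring
  constructor
  · intro w
    have := congrFun h1 w
    rw [Pi.sub_apply] at this
    rw [this, Pi.add_apply]
    refine dvd_add ?_ ?_
    · refine Finset.dvd_sum fun v _ => ((pow_dvd_pow z ha).trans ?_)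
      rw [add_comm, pow_add]
      exact mul_dvd_mul (hH w v) (hg v)
    · refine dvd_mul_of_dvd_right (Finset.dvd_sum fun v _ => dvd_mul_of_dvd_right ?_ _) _
      simp only [gateQuad]
      cases gate v <;> simp
      refine (pow_dvd_pow z ha').trans ?_
      rw [two_mul, pow_add]
      exact mul_dvd_mul (hg _) (hg _)
  · intro w u
    rw [h2, Matrix.sub_apply]
    refine dvd_sub ?_ ?_
    · refine Finset.dvd_sum fun v _ => ((pow_dvd_pow z hb').trans ?_)
      rw [two_mul, pow_add]
      exact mul_dvd_mul (hH w v) (hH v u)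
    · rw [Matrix.smul_apply]
      refine dvd_mul_of_dvd_right (Finset.dvd_sum fun v _ => dvd_mul_of_dvd_left
        (Finset.dvd_sum fun v' _ => dvd_mul_of_dvd_right ((pow_dvd_pow z hb).trans ?_) _) _) _
      rw [hE, of_apply]
      cases gate v' <;> simp
      refine dvd_add ?_ ?_ <;> split_ifs <;> first | exact hg _ | exact dvd_zero _

/-- The inverse lags behind the solution: precisions `(s, s)` become `(2s, s)` and then `(2s, 2s)`,
so two steps double both. The start `(0, 1)` is correct modulo `z`. -/
theorem newton_dvd (gate : V → Gate K σ V) (lab G : V → A) (z : A)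
    (hG : G = z • gateMap gate lab G) (t : ℕ) :
    (∀ w, z ^ 2 ^ t ∣ (newton gate lab z (2 * t)).1 w - G w) ∧
    ∀ w u, z ^ 2 ^ t ∣ (1 - (newton gate lab z (2 * t)).2 * (1 - z • gateJac gate 1 G)) w u := by
  induction t with
  | zero =>
    constructor
    · intro w
      rw [hG]
      simp [newton]
    · intro w u
      simp [newton]
  | succ t ih =>
    have h1 := newton_step gate lab G _ _ z hG ih.1 ih.2 (a' := 2 * 2 ^ t) (b' := 2 ^ t)
      (by omega) le_rfl le_rfl (by omega)
    have h2 := newton_step gate lab G _ _ z hG h1.1 h1.2 (a' := 2 * 2 ^ t) (b' := 2 * 2 ^ t)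
      (by omega) (by omega) le_rfl le_rfl
    rwa [pow_succ']

end Newton

/-! ### Weighted degree bounds and exactness of the iteration -/

section Degree

open Matrix Polynomial

variable {V : Type} {R : Type*} [CommRing R] [Nontrivial R]

/-- The weight `c` is absorbed as a factor `X ^ c`, which turns the bound into membership in a
submodule. Writing it on the left avoids a truncated difference `d - c`: the bound forces zero when
`c > d`. -/
theorem degree_sum_mul_le {ι : Type*} (s : Finset ι) (f : ι → R[X]) (c d : ℕ)
    (h : ∀ i ∈ s, (f i).degree + c ≤ d) : (∑ i ∈ s, f i).degree + c ≤ d := by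
  simp only [← degree_mul_X_pow, ← mem_degreeLE, Finset.sum_mul] at h ⊢
  exact Submodule.sum_mem _ h

theorem degree_add_le_weight {p q : R[X]} {c d : ℕ} (hp : p.degree + c ≤ d)
    (hq : q.degree + c ≤ d) : (p + q).degree + c ≤ d := by
  simp only [← degree_mul_X_pow, ← mem_degreeLE, add_mul] at hp hq ⊢
  exact Submodule.add_mem _ hp hq

omit [Nontrivial R] in
theorem degree_neg_le_weight {p : R[X]} {c d : ℕ} (hp : p.degree + c ≤ d) :
    (-p).degree + c ≤ d := by
  rwa [degree_neg]

/-- Matrices which preserve the vectors of polynomials whose entry at `v` has degree at most `d v`,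
for every vertex `v`. -/
def DegreeBounded (d : V → ℕ) (M : Matrix V V R[X]) : Prop :=
  ∀ w u, (M w u).degree + (d u : WithBot ℕ) ≤ d w

namespace DegreeBounded

variable {d : V → ℕ} {M N : Matrix V V R[X]}

theorem add (hM : DegreeBounded d M) (hN : DegreeBounded d N) : DegreeBounded d (M + N) :=
  fun w u => degree_add_le_weight (hM w u) (hN w u)

theorem sub (hM : DegreeBounded d M) (hN : DegreeBounded d N) : DegreeBounded d (M - N) :=
  fun w u => by
    rw [sub_eq_add_neg]
    exact degree_add_le_weight (hM w u) (degree_neg_le_weight (hN w u))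

theorem one [DecidableEq V] : DegreeBounded d (1 : Matrix V V R[X]) := by
  intro w u
  rw [one_apply]
  split_ifs with h
  · subst h
    simp
  · simp

variable [Fintype V]

theorem mul (hM : DegreeBounded d M) (hN : DegreeBounded d N) : DegreeBounded d (M * N) := by
  intro w u
  refine degree_sum_mul_le _ _ _ _ fun v _ => ?_
  calc _ ≤ (M w v).degree + (N v u).degree + d u := by gcongr; exact degree_mul_le _ _
    _ = (M w v).degree + ((N v u).degree + d u) := add_assoc _ _ _
    _ ≤ (M w v).degree + d v := by gcongr; exact hN v u
    _ ≤ d w := hM w v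

theorem mulVec (hM : DegreeBounded d M) {x : V → R[X]} (hx : ∀ v, (x v).degree ≤ d v) (w : V) :
    ((M *ᵥ x) w).degree ≤ d w := by
  have := degree_sum_mul_le Finset.univ (fun v => M w v * x v) 0 (d w) fun v _ => by
    rw [Nat.cast_zero, add_zero]
    exact (degree_mul_le _ _).trans ((add_le_add_right (hx v) _).trans (hM w v))
  rwa [Nat.cast_zero, add_zero] at this

end DegreeBounded

variable {K σ : Type*}

/-- `d` bounds the number of gates of the parse trees at each gate. -/
structure ParseBound (gate : V → Gate K σ V) (d : V → ℕ) : Prop where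
  one_le : ∀ w, 1 ≤ d w
  add_left : ∀ w l r, gate w = .add l r → d l + 1 ≤ d w
  add_right : ∀ w l r, gate w = .add l r → d r + 1 ≤ d w
  mul : ∀ w l r, gate w = .mul l r → d l + d r + 1 ≤ d w

variable {gate : V → Gate K σ V} {d : V → ℕ}

theorem ParseBound.degree_gateMap (hd : ParseBound gate d) (lab : V → R) {x : V → R[X]} {w : V}
    (hx : ∀ v, (gate w).HasChild v → (x v).degree ≤ d v) :
    ((X : R[X]) * gateMap gate (fun v => Polynomial.C (lab v)) x w).degree ≤ d w := by
  rw [mul_comm, degree_mul_X]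
  have h1 : (1 : WithBot ℕ) ≤ d w := by exact_mod_cast hd.one_le w
  simp only [gateMap]
  split
  · exact (add_le_add_left degree_C_le _).trans (by simpa using h1)
  · exact (add_le_add_left degree_C_le _).trans (by simpa using h1)
  · next l r h =>
    rw [h] at hx
    have hl : (d l : WithBot ℕ) + 1 ≤ d w := by exact_mod_cast hd.add_left w l r h
    have hr : (d r : WithBot ℕ) + 1 ≤ d w := by exact_mod_cast hd.add_right w l r h
    have := degree_add_le_weight (p := x l) (q := x r) (c := 1) (d := d w)
      ((add_le_add_left (hx l (.inl rfl)) _).trans hl)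
      ((add_le_add_left (hx r (.inr rfl)) _).trans hr)
    simpa using this
  · next l r h =>
    rw [h] at hx
    have hm : (d l : WithBot ℕ) + d r + 1 ≤ d w := by exact_mod_cast hd.mul w l r h
    exact (add_le_add_left ((degree_mul_le _ _).trans
      (add_le_add (hx l (.inl rfl)) (hx r (.inr rfl)))) _).trans hm

variable [DecidableEq V]

/-- At a multiplication gate the entry in the column of one child is the value of the other, of
degree at most that child's weight. The additivity of `d` there leaves room for the factor `X`. -/
theorem ParseBound.degreeBounded_gateJac (hd : ParseBound gate d) {x : V → R[X]}
    (hx : ∀ v, (x v).degree ≤ d v) : DegreeBounded d ((X : R[X]) • gateJac gate 1 x) := by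
  intro w u
  rw [Matrix.smul_apply, smul_eq_mul, mul_comm, degree_mul_X, add_assoc]
  have e1 : (1 : WithBot ℕ) + d u = ((1 + d u : ℕ) : WithBot ℕ) := by push_cast; rfl
  rw [e1]
  simp only [gateJac, of_apply]
  split
  · simp
  · simp
  · next l r h =>
    have hl := hd.add_left w l r h
    have hr := hd.add_right w l r h
    apply degree_add_le_weight <;> split_ifs with hu
    · rw [degree_one, zero_add, hu]
      exact_mod_cast by omega
    · simp
    · rw [degree_one, zero_add, hu]
      exact_mod_cast by omega
    · simp
  · next l r h =>
    have hm := hd.mul w l r h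
    apply degree_add_le_weight <;> split_ifs with hu
    · refine (add_le_add_left (hx r) _).trans ?_
      rw [hu]
      exact_mod_cast by omega
    · simp
    · refine (add_le_add_left (hx l) _).trans ?_
      rw [hu]
      exact_mod_cast by omega
    · simp

variable [Fintype V]

/-- Degree-bounded matrices are closed under sums, differences and products and preserve
degree-bounded vectors, and a Newton step is built from these operations. -/
theorem ParseBound.degree_newton (hd : ParseBound gate d) (lab : V → R) (t : ℕ) :
    (∀ w, ((newton gate (fun v => Polynomial.C (lab v)) X t).1 w).degree ≤ d w) ∧
      DegreeBounded d (newton gate (fun v => Polynomial.C (lab v)) X t).2 := by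
  induction t with
  | zero => exact ⟨fun w => by simp [newton], .one⟩
  | succ t ih =>
    obtain ⟨ih1, ih2⟩ := ih
    refine ⟨fun w => ?_,
      (ih2.add ih2).sub ((ih2.mul (.sub .one (hd.degreeBounded_gateJac ih1))).mul ih2)⟩
    refine (degree_add_le _ _).trans (max_le (ih1 w) (ih2.mulVec (fun v => ?_) w))
    exact (degree_sub_le _ _).trans (max_le (hd.degree_gateMap lab fun u _ => ih1 u) (ih1 v))

/-- The Newton iteration computes the exact solution after logarithmically many steps. -/
theorem ParseBound.newton_eq (hd : ParseBound gate d) (lab : V → R) (G : V → R[X])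
    (hG : G = (X : R[X]) • gateMap gate (fun v => Polynomial.C (lab v)) G)
    (hdG : ∀ w, (G w).degree ≤ d w) (t : ℕ) (w : V) (ht : d w < 2 ^ t) :
    (newton gate lab 1 (2 * t)).1 w = (G w).eval 1 := by
  have h1 := (newton_dvd gate _ G X hG t).1 w
  have h2 : ((newton gate (fun v => Polynomial.C (lab v)) X (2 * t)).1 w - G w).degree <
      ((X : R[X]) ^ 2 ^ t).degree := by
    refine lt_of_le_of_lt ((degree_sub_le _ _).trans
      (max_le ((hd.degree_newton lab _).1 w) (hdG w))) ?_
    rw [degree_X_pow]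
    exact_mod_cast ht
  have h3 : (X ^ 2 ^ t : R[X]) ∣ _ := h1
  -- A polynomial divisible by `X ^ 2 ^ t` of degree below `2 ^ t` is zero.
  have h4 := sub_eq_zero.1
    (not_not.1 fun h => (monic_X_pow (R := R) _).not_dvd_of_degree_lt h h2 h3)
  have h5 := newton_map (evalRingHom (1 : R)) gate (fun v => Polynomial.C (lab v)) X (2 * t)
  have h6 : evalRingHom (1 : R) ∘ (fun v => Polynomial.C (lab v)) = lab := by
    funext v
    simp
  rw [h6, coe_evalRingHom, eval_X] at h5
  rw [h5, ← h4]
  rfl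

end Degree

/-! ### Parse tree sizes in multiplicatively disjoint circuits -/

namespace ArithCircuit

open Polynomial

variable {K σ : Type*} [CommRing K] [Nontrivial K] (C : ArithCircuit K σ)

/-- The labels of the input gates. -/
noncomputable def label (w : C.V) : MvPolynomial σ K :=
  match C.gate w with
  | .const a => MvPolynomial.C a
  | .var x => MvPolynomial.X x
  | _ => 0

omit [Nontrivial K] in
theorem value_eq_gateMap : C.value = gateMap C.gate C.label C.value := by
  funext w
  rw [C.value_eq, gateMap]
  split <;> simp [*, Gate.eval, label]

omit [CommRing K] [Nontrivial K] in
-- By acyclicity a gate lies outside its children's subcircuits, which gives the `+ 1`. At a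
-- `×`-gate the two subcircuits are disjoint, so their sizes add inside that of the gate.
theorem parseBound (hC : C.MultiplicativelyDisjoint) :
    ParseBound C.gate (fun w => (C.subcircuit w).ncard) := by
  have hw : ∀ w, w ∈ C.subcircuit w := fun w => .refl
  have hsub : ∀ w u, (C.gate w).HasChild u → C.subcircuit u ⊆ C.subcircuit w :=
    fun w u hu a ha => .tail ha hu
  have hnot : ∀ w u, (C.gate w).HasChild u → w ∉ C.subcircuit u := fun w u hu ha =>
    C.acyclic w (.tail' ha hu)
  have hlt : ∀ w u, (C.gate w).HasChild u →
      (C.subcircuit u).ncard + 1 ≤ (C.subcircuit w).ncard := fun w u hu =>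
    Set.ncard_lt_ncard ((Set.ssubset_iff_of_subset (hsub w u hu)).2 ⟨w, hw w, hnot w u hu⟩)
  refine ⟨fun w => (Set.ncard_pos).2 ⟨w, hw w⟩, fun w l r h => hlt w l (h ▸ .inl rfl),
    fun w l r h => hlt w r (h ▸ .inr rfl), fun w l r h => ?_⟩
  have hl : (C.gate w).HasChild l := h ▸ .inl rfl
  have hr : (C.gate w).HasChild r := h ▸ .inr rfl
  rw [← Set.ncard_union_eq (hC w l r h)]
  exact Set.ncard_lt_ncard ((Set.ssubset_iff_of_subset (Set.union_subset (hsub w l hl)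
    (hsub w r hr))).2 ⟨w, hw w, fun h => h.elim (hnot w l hl) (hnot w r hr)⟩)

/-- The value of a gate, with the parse trees marked by their number of gates. -/
noncomputable def markedValue (C : ArithCircuit K σ) (w : C.V) : (MvPolynomial σ K)[X] :=
  match _h : C.gate w with
  | .const a => X * Polynomial.C (MvPolynomial.C a)
  | .var x => X * Polynomial.C (MvPolynomial.X x)
  | .add l r => X * (C.markedValue l + C.markedValue r)
  | .mul l r => X * (C.markedValue l * C.markedValue r)
termination_by C.wellFounded_child.wrap w
decreasing_by
  all_goals
    show (C.gate w).HasChild _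
    rw [_h]
    simp [Gate.HasChild]

omit [Nontrivial K] in
theorem markedValue_eq :
    C.markedValue = (X : (MvPolynomial σ K)[X]) •
      gateMap C.gate (fun v => Polynomial.C (C.label v)) C.markedValue := by
  funext w
  rw [markedValue, Pi.smul_apply, gateMap, smul_eq_mul]
  split <;> simp [*, label]

omit [Nontrivial K] in
theorem eval_markedValue (w : C.V) : (C.markedValue w).eval 1 = C.value w := by
  induction w using C.wellFounded_child.induction with
  | _ w ih =>
    have ih' : ∀ u, (C.gate w).HasChild u → (C.markedValue u).eval 1 = C.value u := ih
    rw [C.value_eq_gateMap, C.markedValue_eq, Pi.smul_apply, gateMap, gateMap]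
    revert ih'
    cases C.gate w <;> simp +contextual [Gate.HasChild]

theorem newton_eq_value [DecidableEq C.V] (hC : C.MultiplicativelyDisjoint) (t : ℕ)
    (ht : C.size < 2 ^ t) (w : C.V) : (newton C.gate C.label 1 (2 * t)).1 w = C.value w := by
  have hd := C.parseBound hC
  rw [← C.eval_markedValue]
  refine hd.newton_eq _ _ C.markedValue_eq (fun w => ?_) t w (lt_of_le_of_lt ?_ ht)
  · induction w using C.wellFounded_child.induction with
    | _ w ih =>
      rw [C.markedValue_eq]
      exact hd.degree_gateMap _ ih
  · rw [size, ← Nat.card_eq_fintype_card]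
    exact Set.ncard_le_card _

end ArithCircuit

/-! ### Cubic maps by tensors of dimension at most 3 -/

section CubicFormula

variable {K : Type*} {σ : Type*} [CommSemiring K]

theorem StarFormula.exists_cubic {m : ℕ+} (F : StarFormula K σ [m])
    (T : Fin m → (Fin m × Fin m) × Fin m → K) :
    ∃ F' : StarFormula K σ [m],
      (∀ i, F'.eval (i, ()) = ∑ x, T i x •
        (F.eval (x.1.1, ()) * F.eval (x.1.2, ()) * F.eval (x.2, ()))) ∧
      F'.size = 3 * F.size + 2 * m ^ 4 + 4 ∧ F'.maxDim ≤ max 3 F.maxDim := by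
  -- The coefficient tensor has four indices. Two of them are packed into one of range `m * m` to
  -- stay in dimension 3; `D` unpacks it, so that `Q` is the vector of all products of two entries.
  obtain ⟨q, hq⟩ : ∃ q : ℕ+, (q : ℕ) = m * m := ⟨m * m, PNat.mul_coe _ _⟩
  let e : Fin q ≃ Fin m × Fin m := (finCongr hq).trans finProdFinEquiv.symm
  let D : StarFormula K σ ([q, m] ++ [m]) :=
    .input fun x : Fin q × Fin m × Fin m × Unit =>
      .inl (if e x.1 = (x.2.1, x.2.2.1) then 1 else 0)
  let D' : StarFormula K σ ([q] ++ [m]) := .star (ms := []) D F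
  let Q : StarFormula K σ [q] := .star (ms := []) D' F
  let M : StarFormula K σ ([m, m] ++ [q]) :=
    .input fun x : Fin m × Fin m × Fin q × Unit => .inl (T x.1 (e x.2.2.1, x.2.1))
  let M' : StarFormula K σ ([m] ++ [m]) := .star (ms := []) M Q
  refine ⟨.star (ns := [m]) (ms := []) M' F, ?_, ?_, ?_⟩
  · have hD : ∀ p j, D'.eval (p, j, ()) =
        ∑ k, MvPolynomial.C (if e p = (j, k) then 1 else 0) * F.eval (k, ()) := fun _ _ => rfl
    have hQ : ∀ p, Q.eval (p, ()) = F.eval ((e p).1, ()) * F.eval ((e p).2, ()) := by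
      intro p
      change ∑ j, D'.eval (p, j, ()) * F.eval (j, ()) = _
      simp only [hD]
      rw [Finset.sum_eq_single (e p).1, Finset.sum_eq_single (e p).2]
      · simp [mul_comm]
      · intro k _ hk
        rw [if_neg (fun h => hk (by rw [h])), map_zero, zero_mul]
      · simp
      · intro j _ hj
        rw [Finset.sum_eq_zero, zero_mul]
        intro k _
        rw [if_neg (fun h => hj (by rw [h])), map_zero, zero_mul]
      · simp
    have hM : ∀ i l, M'.eval (i, l, ()) =
        ∑ p, MvPolynomial.C (T i (e p, l)) * Q.eval (p, ()) := fun _ _ => rfl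
    intro i
    change ∑ l, M'.eval (i, l, ()) * F.eval (l, ()) = _
    rw [Fintype.sum_prod_type_right]
    refine Finset.sum_congr rfl fun l _ => ?_
    rw [hM, Finset.sum_mul, ← e.sum_comp]
    refine Finset.sum_congr rfl fun p _ => ?_
    rw [hQ, MvPolynomial.smul_eq_C_mul]
    ring
  · change (tensorSize [m, m, q] + (tensorSize [q, m, m] + F.size + 1 + F.size + 1) + 1) +
      F.size + 1 = _
    have h0 : tensorSize [] = 1 := rfl
    simp only [tensorSize_cons, hq, h0]
    ring
  · change max 1 (max (max 2 (max 3 (max 1 (max (max 2 (max 3 F.maxDim)) F.maxDim)))) F.maxDim) ≤ _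
    omega

end CubicFormula

/-! ### Closure properties of cubic forms -/

section Cubic

variable (K : Type*) {A I : Type*} [CommRing K] [CommRing A] [Algebra K A]

/-- The cubic forms over `K` in the entries of vectors indexed by `I`. -/
def cubicForms (A I : Type*) [CommRing A] [Algebra K A] : Submodule K ((I → A) → A) :=
  Submodule.span K (Set.range fun (x : (I × I) × I) (s : I → A) => s x.1.1 * s x.1.2 * s x.2)

variable {K}

theorem mul_mul_mem_cubicForms (a b c : I) :
    (fun s : I → A => s a * s b * s c) ∈ cubicForms K A I :=
  Submodule.subset_span ⟨((a, b), c), rfl⟩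

theorem sum_mem_cubicForms {ι : Type*} (t : Finset ι) {f : ι → (I → A) → A}
    (h : ∀ i, f i ∈ cubicForms K A I) : (fun s => ∑ i ∈ t, f i s) ∈ cubicForms K A I := by
  have := Submodule.sum_mem (cubicForms K A I) (t := t) fun i _ => h i
  convert this using 1
  funext s
  simp

theorem add_mem_cubicForms {f g : (I → A) → A} (hf : f ∈ cubicForms K A I)
    (hg : g ∈ cubicForms K A I) : (fun s => f s + g s) ∈ cubicForms K A I :=
  Submodule.add_mem _ hf hg

theorem sub_mem_cubicForms {f g : (I → A) → A} (hf : f ∈ cubicForms K A I)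
    (hg : g ∈ cubicForms K A I) : (fun s => f s - g s) ∈ cubicForms K A I :=
  Submodule.sub_mem _ hf hg

theorem zero_mem_cubicForms : (fun _ : I → A => 0) ∈ cubicForms K A I :=
  Submodule.zero_mem _

theorem ite_mem_cubicForms {p : Prop} [Decidable p] {f : (I → A) → A}
    (hf : f ∈ cubicForms K A I) : (fun s => if p then f s else 0) ∈ cubicForms K A I := by
  split_ifs
  exacts [hf, zero_mem_cubicForms]

end Cubic

/-! ### A Newton step as a cubic map -/

section NewtonCubic

open Matrix

/-- Positions of the vector that holds the state of the Newton iteration: the constant one, the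
labels, the approximate solution and the approximate inverse. -/
abbrev Slot (V : Type) : Type := Unit ⊕ V ⊕ V ⊕ V × V

variable {V : Type} [DecidableEq V] [Fintype V] {K σ A : Type*} [CommRing A]

/-- The state of the Newton iteration as a vector. -/
def newtonState (gate : V → Gate K σ V) (lab : V → A) (t : ℕ) : Slot V → A :=
  Sum.elim (fun _ => 1) (Sum.elim lab (Sum.elim (newton gate lab 1 t).1
    fun x => (newton gate lab 1 t).2 x.1 x.2))

variable [CommRing K] [Algebra K A]

/-- Terms of lower degree are made cubic by factors from the slot that holds the constant one. The
form `p` depends neither on the labels nor on `t`, so its coefficients lie in `K`. -/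
theorem newtonState_succ (gate : V → Gate K σ V) (i : Slot V) :
    ∃ p ∈ cubicForms K A (Slot V), ∀ (lab : V → A) t,
      newtonState gate lab (t + 1) i = p (newtonState gate lab t) := by
  let o : Slot V := .inl ()
  let L : V → Slot V := fun w => .inr (.inl w)
  let g : V → Slot V := fun w => .inr (.inr (.inl w))
  let H : V → V → Slot V := fun w u => .inr (.inr (.inr (w, u)))
  rcases i with ⟨⟩ | w | w | ⟨w, x⟩
  · exact ⟨_, mul_mul_mem_cubicForms o o o, fun lab t => by simp [newtonState, o]⟩
  · exact ⟨_, mul_mul_mem_cubicForms o o (L w), fun lab t => by simp [newtonState, o, L]⟩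
  · let q : V → (Slot V → A) → A := fun u s => match gate u with
      | .const _ => s (H w u) * s o * s (L u) - s (H w u) * s o * s (g u)
      | .var _ => s (H w u) * s o * s (L u) - s (H w u) * s o * s (g u)
      | .add l r => s (H w u) * s o * s (g l) + s (H w u) * s o * s (g r) -
          s (H w u) * s o * s (g u)
      | .mul l r => s (H w u) * s (g l) * s (g r) - s (H w u) * s o * s (g u)
    have hq : ∀ u, q u ∈ cubicForms K A (Slot V) := by
      intro u
      simp only [q]
      have h := @mul_mul_mem_cubicForms K A (Slot V) _ _ _
      cases gate u
      · exact sub_mem_cubicForms (h _ _ _) (h _ _ _)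
      · exact sub_mem_cubicForms (h _ _ _) (h _ _ _)
      · exact sub_mem_cubicForms (add_mem_cubicForms (h _ _ _) (h _ _ _)) (h _ _ _)
      · exact sub_mem_cubicForms (h _ _ _) (h _ _ _)
    refine ⟨_, add_mem_cubicForms (mul_mul_mem_cubicForms o o (g w))
      (sum_mem_cubicForms Finset.univ hq), fun lab t => ?_⟩
    have e : ∀ u, (newton gate lab 1 t).2 w u * (gateMap gate lab (newton gate lab 1 t).1 u -
        (newton gate lab 1 t).1 u) = q u (newtonState gate lab t) := by
      intro u
      simp only [q, gateMap]
      cases gate u <;> simp [newtonState, o, g, H, L] <;> ring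
    simp only [← e]
    simp [newtonState, newton, o, g, mulVec, dotProduct]
  · let J : V → V → (Slot V → A) → A := fun u v s =>
      s (H w u) * gateJac gate (s o) (fun v => s (g v)) u v * s (H v x)
    have h := @mul_mul_mem_cubicForms K A (Slot V) _ _ _
    have hJ : ∀ u v, J u v ∈ cubicForms K A (Slot V) := by
      intro u v
      simp only [J, gateJac, of_apply]
      cases gate u <;> simp only [mul_add, add_mul, mul_ite, ite_mul, mul_zero, zero_mul]
      · exact zero_mem_cubicForms
      · exact zero_mem_cubicForms
      · exact add_mem_cubicForms (ite_mem_cubicForms (h _ _ _)) (ite_mem_cubicForms (h _ _ _))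
      · exact add_mem_cubicForms (ite_mem_cubicForms (h _ _ _)) (ite_mem_cubicForms (h _ _ _))
    refine ⟨_, sub_mem_cubicForms (add_mem_cubicForms (h o o (H w x)) (h o o (H w x)))
      (sub_mem_cubicForms (sum_mem_cubicForms Finset.univ fun v => h o (H w v) (H v x))
        (sum_mem_cubicForms Finset.univ fun v => sum_mem_cubicForms Finset.univ fun u => hJ u v)),
      fun lab t => ?_⟩
    simp only [newtonState, newton, one_smul, Sum.elim_inr, Sum.elim_inl, o, g, H, J, one_mul,
      mul_sub, sub_mul, mul_one, Matrix.sub_apply, Matrix.add_apply, Matrix.mul_apply,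
      Finset.sum_mul]

end NewtonCubic

/-! ### From circuits to formulas -/

section CircuitToFormula

variable {K : Type*} {σ : Type*} [CommRing K] [Nontrivial K]

omit [Nontrivial K] in
-- With `c = 2 * m ^ 4 + 4`, a step takes size `s` to `3 * s + c`. Adding `c` to the size makes the
-- bound purely geometric.
theorem ArithCircuit.exists_newton_formula (C : ArithCircuit K σ) [DecidableEq C.V] {m : ℕ+}
    (e : Fin m ≃ Slot C.V) (t : ℕ) :
    ∃ F : StarFormula K σ [m], (∀ i, F.eval (i, ()) = newtonState C.gate C.label t (e i)) ∧
      F.size + (2 * m ^ 4 + 4) ≤ 3 ^ t * (m + (2 * m ^ 4 + 4)) ∧ F.maxDim ≤ 3 := by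
  induction t with
  | zero =>
    let T : Slot C.V → K ⊕ σ := Sum.elim (fun _ => .inl 1) (Sum.elim
      (fun w => match C.gate w with
        | .const a => .inl a
        | .var x => .inr x
        | _ => .inl 0)
      (Sum.elim (fun _ => .inl 0) fun x => .inl (if x.1 = x.2 then 1 else 0)))
    refine ⟨.input fun x : Fin m × Unit => T (e x.1), fun i => ?_, ?_, ?_⟩
    · change Sum.elim MvPolynomial.C MvPolynomial.X (T (e i)) = _
      rcases e i with ⟨⟩ | w | w | ⟨w, x⟩
      · simp [T, newtonState]
      · simp only [T, newtonState, Sum.elim_inl, Sum.elim_inr, ArithCircuit.label]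
        cases C.gate w <;> simp
      · simp [T, newtonState, newton]
      · simp [T, newtonState, newton, Matrix.one_apply, apply_ite MvPolynomial.C]
    · have h0 : tensorSize [m] = m := by
        rw [tensorSize_cons]
        exact mul_one _
      change tensorSize [m] + _ ≤ _
      rw [h0, pow_zero, one_mul]
    · exact (by norm_num : 1 ≤ 3)
  | succ t ih =>
    obtain ⟨F, h1, h2, h3⟩ := ih
    choose p hp hp' using newtonState_succ (K := K) (A := MvPolynomial σ K) C.gate
    choose c hc using fun i => (Submodule.mem_span_range_iff_exists_fun K).1 (hp i)
    obtain ⟨F', h1', h2', h3'⟩ := F.exists_cubic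
      fun i x => c (e i) ((e x.1.1, e x.1.2), e x.2)
    refine ⟨F', fun i => ?_, ?_, h3'.trans (max_le le_rfl h3)⟩
    · rw [hp', ← hc, h1', Finset.sum_apply]
      simp only [h1]
      exact ((e.prodCongr e).prodCongr e).sum_comp fun x =>
        c (e i) x • (newtonState C.gate C.label t x.1.1 * newtonState C.gate C.label t x.1.2 *
          newtonState C.gate C.label t x.2)
    · rw [pow_succ' 3 t, h2']
      linarith [Nat.zero_le ((m : ℕ) ^ 4)]

theorem ArithCircuit.exists_starFormula (C : ArithCircuit K σ) {f : MvPolynomial σ K}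
    (hC : C.MultiplicativelyDisjoint) (hf : C.Computes f) :
    ∃ F : StarFormula K σ [], F.Computes f ∧ F.maxDim ≤ 3 ∧
      F.size ≤ (C.size + 1) ^ 2 + 1 +
        16 * C.size ^ 4 * ((C.size + 1) ^ 2 + (2 * ((C.size + 1) ^ 2) ^ 4 + 4)) := by
  classical
  set N := C.size with hN
  have hcard : Fintype.card (Slot C.V) = (N + 1) ^ 2 := by
    simp only [Fintype.card_sum, Fintype.card_prod, Fintype.card_unit, hN, ArithCircuit.size]
    ring
  have hN0 : N ≠ 0 := (Fintype.card_pos_iff.2 ⟨C.output⟩).ne'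
  obtain ⟨m, hm⟩ : ∃ m : ℕ+, (m : ℕ) = (N + 1) ^ 2 := ⟨⟨(N + 1) ^ 2, by positivity⟩, rfl⟩
  let e : Fin m ≃ Slot C.V := (Fintype.equivFinOfCardEq (hcard.trans hm.symm)).symm
  -- This choice gives `N < 2 ^ t`, so that `2 * t` steps are exact, and also `2 ^ t ≤ 2 * N`, so
  -- that `3 ^ (2 * t)` is polynomial in `N`.
  let t := Nat.log 2 N + 1
  obtain ⟨F, h1, h2, h3⟩ := C.exists_newton_formula e (2 * t)
  let i₀ : Fin m := e.symm (.inr (.inr (.inl C.output)))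
  -- Contraction with this unit vector selects the output gate's slot in the approximate solution.
  let U : StarFormula K σ ([] ++ [m]) := .input fun x : Fin m × Unit =>
    .inl (if x.1 = i₀ then 1 else 0)
  refine ⟨.star (ns := []) (ms := []) U F, ⟨rfl, fun _ => ?_⟩, ?_, ?_⟩
  · change ∑ i, MvPolynomial.C (if i = i₀ then 1 else 0) * F.eval (i, ()) = f
    rw [Finset.sum_eq_single i₀ (by simp +contextual) (by simp), if_pos rfl, map_one, one_mul, h1]
    simp only [i₀, Equiv.apply_symm_apply, newtonState, Sum.elim_inr, Sum.elim_inl]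
    rw [C.newton_eq_value hC t (Nat.lt_pow_succ_log_self Nat.one_lt_two _)]
    exact hf
  · change max 0 (max 1 F.maxDim) ≤ 3
    omega
  · have h0 : tensorSize [m] = m := by
      rw [tensorSize_cons]
      exact mul_one _
    change tensorSize [m] + F.size + 1 ≤ _
    have ht : 3 ^ (2 * t) ≤ 16 * N ^ 4 := by
      have h : 2 ^ t ≤ 2 * N := by
        rw [pow_succ']
        exact Nat.mul_le_mul_left _ (Nat.pow_log_le_self 2 hN0)
      calc 3 ^ (2 * t) = 9 ^ t := by norm_num [pow_mul]
        _ ≤ 16 ^ t := Nat.pow_le_pow_left (by norm_num) _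
        _ = (2 ^ t) ^ 4 := by rw [← pow_mul, mul_comm, pow_mul]; norm_num
        _ ≤ (2 * N) ^ 4 := Nat.pow_le_pow_left h _
        _ = 16 * N ^ 4 := by ring
    have h4 := h2.trans (Nat.mul_le_mul_right _ ht)
    rw [h0]
    rw [hm] at h4 ⊢
    omega

theorem exists_starFormula_of_isVP (f : ℕ → MvPolynomial σ K) (hf : IsVP f) :
    ∃ (ns : ℕ → List ℕ+) (F : ∀ n : ℕ, StarFormula K σ (ns n)) (P : Polynomial ℕ),
      ∀ n : ℕ, (F n).Computes (f n) ∧ (F n).size ≤ P.eval n ∧ (F n).maxDim ≤ 3 := by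
  obtain ⟨C, P, h⟩ := hf
  choose F hF using fun n => (C n).exists_starFormula (h n).1 (h n).2.1
  refine ⟨fun _ => [], F, (P + 1) ^ 2 + 1 +
    16 * P ^ 4 * ((P + 1) ^ 2 + (2 * ((P + 1) ^ 2) ^ 4 + 4)),
    fun n => ⟨(hF n).1, (hF n).2.2.trans ?_, (hF n).2.1⟩⟩
  have hn := (h n).2.2
  simp only [Polynomial.eval_add, Polynomial.eval_mul, Polynomial.eval_pow, Polynomial.eval_one,
    Polynomial.eval_ofNat]
  gcongr

end CircuitToFormula
end TensorVP

theorem mainTheorem1 {K : Type*} [Field K] {σ : Type*} (f : ℕ → MvPolynomial σ K) :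
    (TensorVP.IsVP f →
      ∃ (ns : ℕ → List ℕ+) (F : ∀ n : ℕ, TensorVP.StarFormula K σ (ns n)) (P : Polynomial ℕ),
        ∀ n : ℕ, (F n).Computes (f n) ∧ (F n).size ≤ P.eval n ∧ (F n).maxDim ≤ 3) ∧
    ((∃ (ns : ℕ → List ℕ+) (F : ∀ n : ℕ, TensorVP.StarFormula K σ (ns n)) (P : Polynomial ℕ),
        ∀ n : ℕ, (F n).Computes (f n) ∧ (F n).size ≤ P.eval n) →
      TensorVP.IsVP f) :=
  ⟨TensorVP.exists_starFormula_of_isVP f,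
    fun ⟨ns, F, P, h⟩ => TensorVP.isVP_of_starFormula f ns F P h⟩
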